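/- Let $q$ and $a$ be complex numbers with $|q|<1$ and $a\neq 0$. Write $(x;q)_n=\prod_{k=0}^{n-1}(1-xq^k)$ for $n\ge 0$, $(x;q)_\infty=\prod_{k=0}^{\infty}(1-xq^k)$, and $(x,y;q)_n=(x;q)_n(y;q)_n$ for $0\le n\le\infty$. Assume that no denominator below vanishes, i.e. $a^2q^{2n}\neq 1$ and $a^2\neq q^{2n+2}$ for all integers $n\ge 0$. Then the series on the left converges (absolutely) and $$\sum_{n=0}^\infty \left(\frac{(a,q/a;q)_n}{(-a,-q/a;q)_{n+1}}+\frac{(-a,-q/a;q)_n}{(a,q/a;q)_{n+1}}\right)q^{n^2+n}\left(1+q^{2n+1}\right)=2\,\frac{(-q;q)_\infty^2\,(q^2;q^2)_\infty}{(a^2,q^2/a^2;q^2)_\infty}.$$ -/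

import Mathlib

/-- The finite `q`-shifted factorial `(a; q)_n = (1 - a) (1 - a q) ⋯ (1 - a q ^ (n - 1))`. -/
noncomputable def qShifted (a q : ℂ) (n : ℕ) : ℂ :=
  ∏ k ∈ Finset.range n, (1 - a * q ^ k)

/-- The infinite `q`-shifted factorial `(a; q)_∞ = ∏_{n ≥ 0} (1 - a q ^ n)`, used for `‖q‖ < 1`. -/
noncomputable def qShiftedInf (a q : ℂ) : ℂ :=
  ∏' k : ℕ, (1 - a * q ^ k)

/-- For `‖q‖ < 1` the product defining `(a; q)_∞` converges, so `qShiftedInf` is a genuine value. -/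
theorem qShiftedInf_multipliable (a q : ℂ) (hq : ‖q‖ < 1) :
    Multipliable (fun k : ℕ => 1 - a * q ^ k) := by
  have h : Summable (fun k : ℕ => ‖-(a * q ^ k)‖) := by
    simp only [norm_neg, norm_mul, norm_pow]
    exact (summable_geometric_of_lt_one (norm_nonneg q) hq).mul_left _
  simpa [sub_eq_add_neg] using multipliable_one_add_of_summable h

/-! The left side is `S(a) + S(-a)`, where `S` sums `wellPoisedTerm`. Weighting the `n`-th term by
`1 / ((q²;q²)_{N-n} (q²;q²)_{N+1+n})` gives a finite sum with a first-order recurrence in `N`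
(`baileySum_recurrence`), proved by creative telescoping. Its coefficients are even in `a` and its
inhomogeneous term is odd, so the sums for `a` and `-a` together obey a homogeneous recurrence and
equal a product (`baileySum_add_baileySum_neg`). As `N → ∞` the weights tend to `1 / (q²;q²)_∞²`,
and dominated convergence (`tendsto_baileySum`) yields the theorem. -/

theorem qShifted_zero (x q : ℂ) : qShifted x q 0 = 1 := by
  simp [qShifted]

theorem qShifted_succ (x q : ℂ) (n : ℕ) :
    qShifted x q (n + 1) = qShifted x q n * (1 - x * q ^ n) := by
  simp [qShifted, Finset.prod_range_succ]

theorem qShifted_ne_zero {x q : ℂ} (h : ∀ n : ℕ, 1 - x * q ^ n ≠ 0) (n : ℕ) :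
    qShifted x q n ≠ 0 :=
  Finset.prod_ne_zero_iff.mpr fun k _ => h k

theorem qShifted_sq_sq (x q : ℂ) (n : ℕ) :
    qShifted (x ^ 2) (q ^ 2) n = qShifted x q n * qShifted (-x) q n := by
  rw [qShifted, qShifted, qShifted, ← Finset.prod_mul_distrib]
  exact Finset.prod_congr rfl fun k _ => by ring

/-! ### Finite sums and their recurrence -/

/-- The summand of one half of the bilateral very-well-poised series. -/
noncomputable def wellPoisedTerm (q a : ℂ) (n : ℕ) : ℂ :=
  (qShifted a q n * qShifted (q / a) q n) /
    (qShifted (-a) q (n + 1) * qShifted (-q / a) q (n + 1)) *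
    q ^ (n ^ 2 + n) * (1 + q ^ (2 * n + 1))

/-- The Bailey transform of `wellPoisedTerm`, in base `q ^ 2` and relative to `q ^ 2`. -/
noncomputable def baileySum (q a : ℂ) (N : ℕ) : ℂ :=
  ∑ n ∈ Finset.range (N + 1), wellPoisedTerm q a n /
    (qShifted (q ^ 2) (q ^ 2) (N - n) * qShifted (q ^ 2) (q ^ 2) (N + 1 + n))

/-- The telescoping certificate for the recurrence satisfied by `baileySum`. -/
noncomputable def baileyCert (q a : ℂ) (N n : ℕ) : ℂ :=
  (qShifted a q n * qShifted (q / a) q n) / (qShifted (-a) q n * qShifted (-q / a) q n) *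
    q ^ (n * (n - 1)) * q ^ (2 * N + 2) *
    ((1 + q ^ (2 * N + 3)) * (q ^ (2 * n) - 1) + (a + q / a) * (1 - q ^ (2 * N + 2)) * q ^ n) /
    (qShifted (q ^ 2) (q ^ 2) (N + 1 - n) * qShifted (q ^ 2) (q ^ 2) (N + 1 + n))

/-- The coefficient of `baileySum q a (N + 1)` in its recurrence. -/
noncomputable def baileyCoeff (q a : ℂ) (N : ℕ) : ℂ :=
  (1 - q ^ (2 * N + 2)) * (1 - q ^ (2 * N + 3)) * (1 - a ^ 2 * q ^ (2 * N + 2)) *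
    (1 - q ^ (2 * N + 4) / a ^ 2)

theorem one_sub_qpow_ne_zero {q : ℂ} (hq : ‖q‖ < 1) {n : ℕ} (hn : n ≠ 0) : 1 - q ^ n ≠ 0 := by
  intro h
  have h1 : ‖q ^ n‖ = 1 := by rw [← sub_eq_zero.mp h, norm_one]
  rw [norm_pow] at h1
  exact (pow_lt_one₀ (norm_nonneg q) hq hn).ne h1

theorem one_add_qpow_ne_zero {q : ℂ} (hq : ‖q‖ < 1) {n : ℕ} (hn : n ≠ 0) : 1 + q ^ n ≠ 0 := by
  intro h
  have h1 : ‖q ^ n‖ = 1 := by rw [eq_neg_of_add_eq_zero_right h, norm_neg, norm_one]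
  rw [norm_pow] at h1
  exact (pow_lt_one₀ (norm_nonneg q) hq hn).ne h1

theorem qShifted_sq_base_ne_zero {q : ℂ} (hq : ‖q‖ < 1) (n : ℕ) :
    qShifted (q ^ 2) (q ^ 2) n ≠ 0 := by
  refine qShifted_ne_zero (fun k => ?_) n
  have := one_sub_qpow_ne_zero hq (n := 2 * k + 2) (by omega)
  rwa [show q ^ 2 * (q ^ 2) ^ k = q ^ (2 * k + 2) by ring]

/-- Writing `N = n + k` removes the truncated subtractions. Once the common factors cancel, what
remains is a polynomial identity in `q`, `a`, `q ^ n` and `q ^ k`. -/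
theorem baileyCert_telescope {q a : ℂ} (hq : ‖q‖ < 1) (ha : a ≠ 0)
    (h1 : ∀ n : ℕ, 1 - -a * q ^ n ≠ 0) (h2 : ∀ n : ℕ, 1 - -q / a * q ^ n ≠ 0) (n k : ℕ) :
    baileyCoeff q a (n + k) * (wellPoisedTerm q a n /
        (qShifted (q ^ 2) (q ^ 2) (n + k + 1 - n) * qShifted (q ^ 2) (q ^ 2) (n + k + 1 + 1 + n))) -
      (1 + q ^ (2 * (n + k) + 2)) * (1 + q ^ (2 * (n + k) + 3)) * (wellPoisedTerm q a n /
        (qShifted (q ^ 2) (q ^ 2) (n + k - n) * qShifted (q ^ 2) (q ^ 2) (n + k + 1 + n))) =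
      baileyCert q a (n + k) (n + 1) - baileyCert q a (n + k) n := by
  have hD1 := qShifted_ne_zero h1 n
  have hD2 := qShifted_ne_zero h2 n
  have hp1 := qShifted_sq_base_ne_zero hq k
  have hp2 := qShifted_sq_base_ne_zero hq (n + k + 1 + n)
  have hk := one_sub_qpow_ne_zero hq (n := 2 * k + 2) (by omega)
  have hm := one_sub_qpow_ne_zero hq (n := 4 * n + 2 * k + 4) (by omega)
  have e1 : n + k + 1 - n = k + 1 := by omega
  have e2 : n + k - n = k := by omega
  have e3 : n + k + 1 - (n + 1) = k := by omega
  have e4 : n + k + 1 + (n + 1) = n + k + 1 + n + 1 := by omega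
  have e5 : n + k + 1 + 1 + n = n + k + 1 + n + 1 := by omega
  have e6 : (n + 1) * (n + 1 - 1) = n * (n - 1) + 2 * n := by
    cases n with
    | zero => simp
    | succ m => simp only [Nat.add_sub_cancel]; ring
  have e7 : n ^ 2 + n = n * (n - 1) + 2 * n := by rw [← e6]; simp only [Nat.add_sub_cancel]; ring
  have h1n := h1 n
  have h2n := h2 n
  simp only [baileyCoeff, baileyCert, wellPoisedTerm, e1, e2, e3, e4, e5, e6, e7, qShifted_succ]
  have f1 : q ^ 2 * (q ^ 2) ^ k = q ^ (2 * k + 2) := by ring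
  have f2 : q ^ 2 * (q ^ 2) ^ (n + k + 1 + n) = q ^ (4 * n + 2 * k + 4) := by ring
  rw [f1, f2]
  have h2n' : a + q * q ^ n ≠ 0 := by
    intro h
    apply h2n
    field_simp
    linear_combination h
  have h2e : 1 - -q / a * q ^ n = (a + q * q ^ n) / a := by field_simp; ring
  have h2f : 1 - q / a * q ^ n = (a - q * q ^ n) / a := by field_simp
  have h1e : 1 - -a * q ^ n = 1 + a * q ^ n := by ring
  rw [h1e] at h1n
  rw [h2e, h2f, h1e]
  generalize qShifted (q ^ 2) (q ^ 2) (n + k + 1 + n) = P2 at *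
  generalize qShifted (q ^ 2) (q ^ 2) k = P1 at *
  generalize qShifted a q n = A1 at *
  generalize qShifted (q / a) q n = A2 at *
  generalize qShifted (-a) q n = D1 at *
  generalize qShifted (-q / a) q n = D2 at *
  have g1 : q ^ (2 * k + 2) = (q ^ k) ^ 2 * q ^ 2 := by ring
  have g2 : q ^ (4 * n + 2 * k + 4) = (q ^ n) ^ 4 * (q ^ k) ^ 2 * q ^ 4 := by ring
  have g3 (j : ℕ) : q ^ (2 * (n + k) + j) = (q ^ n) ^ 2 * (q ^ k) ^ 2 * q ^ j := by ring
  have g4 : q ^ (2 * n + 1) = (q ^ n) ^ 2 * q := by ring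
  have g5 : q ^ (2 * (n + 1)) = (q ^ n) ^ 2 * q ^ 2 := by ring
  have g6 : q ^ (2 * n) = (q ^ n) ^ 2 := by ring
  have g7 : q ^ (n + 1) = q ^ n * q := by ring
  have g8 : q ^ (n * (n - 1) + 2 * n) = q ^ (n * (n - 1)) * (q ^ n) ^ 2 := by ring
  rw [g1] at hk
  rw [g2] at hm
  simp only [g1, g2, g3, g4, g5, g6, g7, g8]
  generalize q ^ (n * (n - 1)) = w at *
  generalize q ^ n = x at *
  generalize q ^ k = z at *
  -- Nonzero factors become atoms so that `field_simp` clears them whole; they are expanded again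
  -- for `ring`.
  generalize hE1 : 1 + a * x = E1 at *
  generalize hE2 : a + q * x = E2 at *
  generalize hE3 : 1 - z ^ 2 * q ^ 2 = E3 at *
  generalize hE4 : 1 - x ^ 4 * z ^ 2 * q ^ 4 = E4 at *
  field_simp
  subst hE1 hE2 hE3 hE4
  ring

/-- The term `n = N + 1` occurs only in the sum for `N + 1`. It closes the telescope, as if the
certificate vanished at `N + 2`. -/
theorem baileyCert_last {q a : ℂ} (hq : ‖q‖ < 1) (ha : a ≠ 0)
    (h1 : ∀ n : ℕ, 1 - -a * q ^ n ≠ 0) (h2 : ∀ n : ℕ, 1 - -q / a * q ^ n ≠ 0) (N : ℕ) :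
    baileyCoeff q a N * (wellPoisedTerm q a (N + 1) /
        (qShifted (q ^ 2) (q ^ 2) (N + 1 - (N + 1)) *
          qShifted (q ^ 2) (q ^ 2) (N + 1 + 1 + (N + 1)))) =
      -baileyCert q a N (N + 1) := by
  have hD1 := qShifted_ne_zero h1 (N + 1)
  have hD2 := qShifted_ne_zero h2 (N + 1)
  have hp2 := qShifted_sq_base_ne_zero hq (2 * N + 2)
  have hm := one_sub_qpow_ne_zero hq (n := 4 * N + 6) (by omega)
  have e1 : N + 1 + 1 + (N + 1) = 2 * N + 2 + 1 := by omega
  have e2 : N + 1 + (N + 1) = 2 * N + 2 := by omega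
  have e6 : (N + 1) * (N + 1 - 1) = N * N + N := by simp only [Nat.add_sub_cancel]; ring
  have h1n := h1 (N + 1)
  have h2n := h2 (N + 1)
  simp only [baileyCoeff, baileyCert, wellPoisedTerm, e1, e2, e6, Nat.sub_self, qShifted_zero,
    qShifted_succ _ _ (N + 1), qShifted_succ _ _ (2 * N + 2)]
  have f2 : q ^ 2 * (q ^ 2) ^ (2 * N + 2) = q ^ (4 * N + 6) := by ring
  rw [f2]
  have h2n' : a + q * q ^ (N + 1) ≠ 0 := by
    intro h
    apply h2n
    field_simp
    linear_combination h
  have h2e : 1 - -q / a * q ^ (N + 1) = (a + q * q ^ (N + 1)) / a := by field_simp; ring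
  have h1e : 1 - -a * q ^ (N + 1) = 1 + a * q ^ (N + 1) := by ring
  rw [h1e] at h1n
  rw [h2e, h1e]
  generalize qShifted (q ^ 2) (q ^ 2) (2 * N + 2) = P2 at *
  generalize qShifted a q (N + 1) = A1 at *
  generalize qShifted (q / a) q (N + 1) = A2 at *
  generalize qShifted (-a) q (N + 1) = D1 at *
  generalize qShifted (-q / a) q (N + 1) = D2 at *
  have g2 : q ^ (4 * N + 6) = (q ^ N) ^ 4 * q ^ 6 := by ring
  have g3 (j : ℕ) : q ^ (2 * N + j) = (q ^ N) ^ 2 * q ^ j := by ring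
  have g4 : q ^ (2 * (N + 1) + 1) = (q ^ N) ^ 2 * q ^ 3 := by ring
  have g5 : q ^ (2 * (N + 1)) = (q ^ N) ^ 2 * q ^ 2 := by ring
  have g7 : q ^ (N + 1) = q ^ N * q := by ring
  have g8 : q ^ ((N + 1) ^ 2 + (N + 1)) = q ^ (N * N + N) * (q ^ N) ^ 2 * q ^ 2 := by ring
  rw [g2] at hm
  rw [g7] at h1n h2n'
  simp only [g2, g3, g4, g5, g7, g8]
  generalize q ^ (N * N + N) = w at *
  generalize q ^ N = x at *
  generalize hE1 : 1 + a * (x * q) = E1 at *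
  generalize hE2 : a + q * (x * q) = E2 at *
  generalize hE4 : 1 - x ^ 4 * q ^ 6 = E4 at *
  field_simp
  subst hE1 hE2 hE4
  ring

theorem baileySum_recurrence {q a : ℂ} (hq : ‖q‖ < 1) (ha : a ≠ 0)
    (h1 : ∀ n : ℕ, 1 - -a * q ^ n ≠ 0) (h2 : ∀ n : ℕ, 1 - -q / a * q ^ n ≠ 0) (N : ℕ) :
    baileyCoeff q a N * baileySum q a (N + 1) -
      (1 + q ^ (2 * N + 2)) * (1 + q ^ (2 * N + 3)) * baileySum q a N = -baileyCert q a N 0 := by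
  rw [baileySum, Finset.sum_range_succ, mul_add, baileyCert_last hq ha h1 h2, baileySum,
    Finset.mul_sum, Finset.mul_sum, add_sub_right_comm, ← Finset.sum_sub_distrib]
  rw [Finset.sum_congr rfl (g := fun n => baileyCert q a N (n + 1) - baileyCert q a N n)
    fun n hn => by
      obtain ⟨k, rfl⟩ := Nat.exists_eq_add_of_le (Nat.lt_succ_iff.mp (Finset.mem_range.mp hn))
      exact baileyCert_telescope hq ha h1 h2 n k, Finset.sum_range_sub]
  ring

/-! ### Symmetrization in `a` and the finite product formula -/

theorem baileyCert_neg_zero (q a : ℂ) (N : ℕ) : baileyCert q (-a) N 0 = -baileyCert q a N 0 := by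
  simp only [baileyCert, qShifted_zero]
  ring

theorem baileyCoeff_neg (q a : ℂ) (N : ℕ) : baileyCoeff q (-a) N = baileyCoeff q a N := by
  simp only [baileyCoeff, even_two.neg_pow]

theorem baileySum_add_baileySum_neg {q a : ℂ} (hq : ‖q‖ < 1) (ha : a ≠ 0)
    (h₁ : ∀ n : ℕ, 1 - a ^ 2 * (q ^ 2) ^ n ≠ 0) (h₂ : ∀ n : ℕ, 1 - q ^ 2 / a ^ 2 * (q ^ 2) ^ n ≠ 0)
    (N : ℕ) :
    baileySum q a N + baileySum q (-a) N =
      2 * qShifted (-q) q (2 * N + 1) / (qShifted q q (2 * N + 1) *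
        (qShifted (a ^ 2) (q ^ 2) (N + 1) * qShifted (q ^ 2 / a ^ 2) (q ^ 2) (N + 1))) := by
  have k1 (n : ℕ) : 1 - a * q ^ n ≠ 0 := fun h => h₁ n (by
    linear_combination (1 + a * q ^ n) * h)
  have k2 (n : ℕ) : 1 - -a * q ^ n ≠ 0 := fun h => h₁ n (by
    linear_combination (1 - a * q ^ n) * h)
  have k3 (n : ℕ) : 1 - q / a * q ^ n ≠ 0 := fun h => h₂ n (by
    linear_combination (1 + q / a * q ^ n) * h)
  have k4 (n : ℕ) : 1 - -q / a * q ^ n ≠ 0 := fun h => h₂ n (by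
    linear_combination (1 - q / a * q ^ n) * h)
  have kq (n : ℕ) : 1 - q * q ^ n ≠ 0 := by
    rw [← pow_succ']; exact one_sub_qpow_ne_zero hq (by omega)
  induction N with
  | zero =>
    have a1 := k1 0
    have a2 := k2 0
    have a3 := k3 0
    have a4 := k4 0
    have a5 := kq 0
    have a6 := h₁ 0
    have a7 := h₂ 0
    have a8 := one_sub_qpow_ne_zero hq (n := 2) (by omega)
    simp only [pow_zero, mul_one] at a1 a2 a3 a4 a5 a6 a7
    have b3 : a - q ≠ 0 := fun h => a3 (by field_simp; linear_combination h)
    have b4 : a + q ≠ 0 := fun h => a4 (by field_simp; linear_combination h)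
    have b2 : 1 + a ≠ 0 := fun h => a2 (by linear_combination h)
    have b7 : a ^ 2 - q ^ 2 ≠ 0 := fun h => a7 (by field_simp; linear_combination h)
    have c4 : 1 - -q / a = (a + q) / a := by field_simp; ring
    have c6 : 1 - -q / -a = (a - q) / a := by field_simp
    have c7 : 1 - q ^ 2 / a ^ 2 = (a - q) * (a + q) / a ^ 2 := by field_simp; ring
    have c8 : 1 - q ^ 2 = (1 - q) * (1 + q) := by ring
    have c9 : 1 - a ^ 2 = (1 - a) * (1 + a) := by ring
    have b8 : 1 + q ≠ 0 := fun h => a8 (by linear_combination (1 - q) * h)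
    simp only [baileySum, wellPoisedTerm, Finset.sum_range_one, qShifted_succ, qShifted_zero,
      Nat.sub_self, zero_add, mul_zero, pow_zero, mul_one, one_mul, pow_one, add_zero, neg_neg,
      sub_neg_eq_add, ne_eq, OfNat.ofNat_ne_zero, not_false_eq_true, zero_pow, c4, c6, c7, c8, c9]
    field_simp
    ring
  | succ N ih =>
    have hA : baileyCoeff q a N ≠ 0 := by
      refine mul_ne_zero (mul_ne_zero (mul_ne_zero (one_sub_qpow_ne_zero hq (by omega))
        (one_sub_qpow_ne_zero hq (by omega))) ?_) ?_
      · convert h₁ (N + 1) using 2; ring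
      · convert h₂ (N + 1) using 2; ring
    have r1 := baileySum_recurrence hq ha k2 k4 N
    have r2 := baileySum_recurrence hq (neg_ne_zero.mpr ha) (a := -a)
      (by simpa only [neg_neg] using k1) (by simpa only [neg_div_neg_eq] using k3) N
    rw [baileyCoeff_neg, baileyCert_neg_zero] at r2
    apply mul_left_cancel₀ hA
    -- The boundary terms at `n = 0` are opposite and cancel.
    have r3 : baileyCoeff q a N * (baileySum q a (N + 1) + baileySum q (-a) (N + 1)) =
        (1 + q ^ (2 * N + 2)) * (1 + q ^ (2 * N + 3)) * (baileySum q a N + baileySum q (-a) N) := by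
      linear_combination r1 + r2
    rw [r3, ih]
    have n1 := qShifted_ne_zero h₁ (N + 1)
    have n2 := qShifted_ne_zero h₂ (N + 1)
    have n3 := qShifted_ne_zero kq (2 * N + 1)
    have n4 := h₁ (N + 1)
    have n5 := h₂ (N + 1)
    have n6 := kq (2 * N + 1)
    have n7 := kq (2 * N + 2)
    rw [show 2 * (N + 1) + 1 = 2 * N + 1 + 1 + 1 by ring]
    simp only [qShifted_succ _ _ (2 * N + 1 + 1), qShifted_succ _ _ (2 * N + 1),
      qShifted_succ _ _ (N + 1)]
    -- The coefficient consists exactly of the factors that the denominator gains from `N` to `N +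
    -- 1`.
    have m1 : baileyCoeff q a N = (1 - q * q ^ (2 * N + 1)) * (1 - q * q ^ (2 * N + 2)) *
        (1 - a ^ 2 * (q ^ 2) ^ (N + 1)) * (1 - q ^ 2 / a ^ 2 * (q ^ 2) ^ (N + 1)) := by
      rw [baileyCoeff]; ring
    rw [m1]
    generalize 1 - q ^ 2 / a ^ 2 * (q ^ 2) ^ (N + 1) = u1 at *
    generalize 1 - a ^ 2 * (q ^ 2) ^ (N + 1) = u2 at *
    generalize qShifted (q ^ 2 / a ^ 2) (q ^ 2) (N + 1) = u3 at *
    generalize qShifted (a ^ 2) (q ^ 2) (N + 1) = u4 at *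
    generalize qShifted q q (2 * N + 1) = u5 at *
    generalize 1 - q * q ^ (2 * N + 1) = u6 at *
    rw [show 2 * N + 1 + 1 = 2 * N + 2 by ring]
    generalize 1 - q * q ^ (2 * N + 2) = u7 at *
    field_simp
    ring

/-! ### Convergence and the limit `N → ∞` -/

theorem tendsto_qShifted (x : ℂ) {q : ℂ} (hq : ‖q‖ < 1) :
    Filter.Tendsto (qShifted x q) Filter.atTop (nhds (qShiftedInf x q)) :=
  (qShiftedInf_multipliable x q hq).hasProd.tendsto_prod_nat

theorem qShiftedInf_ne_zero {x q : ℂ} (hq : ‖q‖ < 1) (h : ∀ n : ℕ, 1 - x * q ^ n ≠ 0) :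
    qShiftedInf x q ≠ 0 := by
  have hs : Summable fun k : ℕ => ‖-(x * q ^ k)‖ := by
    simp only [norm_neg, norm_mul, norm_pow]
    exact (summable_geometric_of_lt_one (norm_nonneg q) hq).mul_left _
  simpa only [qShiftedInf, sub_eq_add_neg] using
    tprod_one_add_ne_zero_of_summable (by simpa only [sub_eq_add_neg] using h) hs

theorem exists_norm_le_of_tendsto {u : ℕ → ℂ} {l : ℂ}
    (h : Filter.Tendsto u Filter.atTop (nhds l)) : ∃ C, 0 ≤ C ∧ ∀ n, ‖u n‖ ≤ C := by
  obtain ⟨C, hC⟩ := (Metric.isBounded_range_of_tendsto u h).exists_norm_le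
  have hC' (n : ℕ) : ‖u n‖ ≤ C := hC _ (Set.mem_range_self n)
  exact ⟨C, (norm_nonneg _).trans (hC' 0), hC'⟩

/-- The quotient of shifted factorials converges, hence is bounded, and `q ^ (n ^ 2 + n)` is
dominated by a geometric sequence. -/
theorem summable_norm_wellPoisedTerm {q a : ℂ} (hq : ‖q‖ < 1)
    (h1 : ∀ n : ℕ, 1 - -a * q ^ n ≠ 0) (h2 : ∀ n : ℕ, 1 - -q / a * q ^ n ≠ 0) :
    Summable fun n => ‖wellPoisedTerm q a n‖ := by
  have hlim := ((tendsto_qShifted a hq).mul (tendsto_qShifted (q / a) hq)).div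
    (((tendsto_qShifted (-a) hq).comp (Filter.tendsto_add_atTop_nat 1)).mul
      ((tendsto_qShifted (-q / a) hq).comp (Filter.tendsto_add_atTop_nat 1)))
    (mul_ne_zero (qShiftedInf_ne_zero hq h1) (qShiftedInf_ne_zero hq h2))
  obtain ⟨C, hC0, hC⟩ := exists_norm_le_of_tendsto hlim
  refine Summable.of_nonneg_of_le (fun n => norm_nonneg _) (fun n => ?_)
    ((summable_geometric_of_lt_one (norm_nonneg q) hq).mul_left (C * 2))
  have b1 : ‖q ^ (n ^ 2 + n)‖ ≤ ‖q‖ ^ n := by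
    rw [norm_pow]
    exact pow_le_pow_of_le_one (norm_nonneg q) hq.le (Nat.le_add_left _ _)
  have b2 : ‖1 + q ^ (2 * n + 1)‖ ≤ 2 := by
    refine (norm_add_le _ _).trans ?_
    rw [norm_one, norm_pow]
    linarith [pow_le_one₀ (n := 2 * n + 1) (norm_nonneg q) hq.le]
  rw [wellPoisedTerm, norm_mul, norm_mul]
  calc _ ≤ C * ‖q‖ ^ n * 2 := by
        gcongr
        exact hC n
    _ = C * 2 * ‖q‖ ^ n := by ring

theorem tendsto_baileySum {q a : ℂ} (hq : ‖q‖ < 1)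
    (h1 : ∀ n : ℕ, 1 - -a * q ^ n ≠ 0) (h2 : ∀ n : ℕ, 1 - -q / a * q ^ n ≠ 0) :
    Filter.Tendsto (baileySum q a) Filter.atTop
      (nhds ((∑' n, wellPoisedTerm q a n) / qShiftedInf (q ^ 2) (q ^ 2) ^ 2)) := by
  have hq2 : ‖q ^ 2‖ < 1 := by
    rw [norm_pow]; exact pow_lt_one₀ (norm_nonneg q) hq two_ne_zero
  have hP : qShiftedInf (q ^ 2) (q ^ 2) ≠ 0 := qShiftedInf_ne_zero hq2 fun k => by
    have := one_sub_qpow_ne_zero hq (n := 2 * k + 2) (by omega)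
    rwa [show q ^ 2 * (q ^ 2) ^ k = q ^ (2 * k + 2) by ring]
  have hinv := (tendsto_qShifted (q ^ 2) hq2).inv₀ hP
  -- `C` bounds every `1 / (q²;q²)_m`, so `C * C` bounds the weights uniformly in `N` and `n`.
  obtain ⟨C, hC0, hC⟩ := exists_norm_le_of_tendsto hinv
  have key := tendsto_tsum_of_dominated_convergence (𝓕 := Filter.atTop)
    (f := fun N n : ℕ => if n ∈ Finset.range (N + 1) then wellPoisedTerm q a n /
      (qShifted (q ^ 2) (q ^ 2) (N - n) * qShifted (q ^ 2) (q ^ 2) (N + 1 + n)) else 0)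
    (g := fun n => wellPoisedTerm q a n / qShiftedInf (q ^ 2) (q ^ 2) ^ 2)
    ((summable_norm_wellPoisedTerm hq h1 h2).mul_right (C * C)) ?_ ?_
  · rw [tsum_div_const] at key
    refine key.congr fun N => ?_
    rw [tsum_eq_sum (s := Finset.range (N + 1)) fun n hn => if_neg hn, baileySum]
    exact Finset.sum_congr rfl fun n hn => if_pos hn
  · intro n
    have t1 := (tendsto_qShifted (q ^ 2) hq2).comp (Filter.tendsto_sub_atTop_nat n)
    have t2 := (tendsto_qShifted (q ^ 2) hq2).comp (Filter.tendsto_add_atTop_nat (1 + n))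
    have t3 := (tendsto_const_nhds (x := wellPoisedTerm q a n)).div (t1.mul t2) (mul_ne_zero hP hP)
    rw [← pow_two] at t3
    refine t3.congr' ?_
    filter_upwards [Filter.eventually_ge_atTop n] with N hN
    rw [if_pos (Finset.mem_range.mpr (Nat.lt_succ_of_le hN))]
    simp [add_assoc]
  · refine Filter.Eventually.of_forall fun N n => ?_
    split_ifs
    · rw [div_eq_mul_inv, norm_mul, mul_inv, norm_mul]
      gcongr
      · exact hC _
      · exact hC _
    · rw [norm_zero]
      positivity

theorem qShiftedInf_sq_sq {q : ℂ} (hq : ‖q‖ < 1) :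
    qShiftedInf (q ^ 2) (q ^ 2) = qShiftedInf q q * qShiftedInf (-q) q := by
  have hq2 : ‖q ^ 2‖ < 1 := by
    rw [norm_pow]; exact pow_lt_one₀ (norm_nonneg q) hq two_ne_zero
  refine tendsto_nhds_unique (tendsto_qShifted (q ^ 2) hq2) ?_
  exact ((tendsto_qShifted q hq).mul (tendsto_qShifted (-q) hq)).congr fun n =>
    (qShifted_sq_sq q q n).symm

theorem mainTheorem10 (q a : ℂ) (hq : ‖q‖ < 1) (ha : a ≠ 0)
    (h₁ : ∀ n : ℕ, a ^ 2 * q ^ (2 * n) ≠ 1)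
    (h₂ : ∀ n : ℕ, a ^ 2 ≠ q ^ (2 * n + 2)) :
    HasSum
      (fun n : ℕ =>
        ((qShifted a q n * qShifted (q / a) q n) /
            (qShifted (-a) q (n + 1) * qShifted (-q / a) q (n + 1)) +
          (qShifted (-a) q n * qShifted (-q / a) q n) /
            (qShifted a q (n + 1) * qShifted (q / a) q (n + 1))) *
          q ^ (n ^ 2 + n) * (1 + q ^ (2 * n + 1)))
      (2 * ((qShiftedInf (-q) q ^ 2 * qShiftedInf (q ^ 2) (q ^ 2)) /
        (qShiftedInf (a ^ 2) (q ^ 2) * qShiftedInf (q ^ 2 / a ^ 2) (q ^ 2)))) := by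
  have hq2 : ‖q ^ 2‖ < 1 := by
    rw [norm_pow]; exact pow_lt_one₀ (norm_nonneg q) hq two_ne_zero
  have H₁ (n : ℕ) : 1 - a ^ 2 * (q ^ 2) ^ n ≠ 0 := by
    rw [← pow_mul]; exact sub_ne_zero.mpr (h₁ n).symm
  have H₂ (n : ℕ) : 1 - q ^ 2 / a ^ 2 * (q ^ 2) ^ n ≠ 0 := fun h => h₂ n (by
    field_simp at h
    linear_combination h)
  have k1 (n : ℕ) : 1 - a * q ^ n ≠ 0 := fun h => H₁ n (by
    linear_combination (1 + a * q ^ n) * h)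
  have k2 (n : ℕ) : 1 - -a * q ^ n ≠ 0 := fun h => H₁ n (by
    linear_combination (1 - a * q ^ n) * h)
  have k3 (n : ℕ) : 1 - q / a * q ^ n ≠ 0 := fun h => H₂ n (by
    linear_combination (1 + q / a * q ^ n) * h)
  have k4 (n : ℕ) : 1 - -q / a * q ^ n ≠ 0 := fun h => H₂ n (by
    linear_combination (1 - q / a * q ^ n) * h)
  have k1' (n : ℕ) : 1 - - -a * q ^ n ≠ 0 := by simpa only [neg_neg] using k1 n
  have k3' (n : ℕ) : 1 - -q / -a * q ^ n ≠ 0 := by simpa only [neg_div_neg_eq] using k3 n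
  have kq (n : ℕ) : 1 - q * q ^ n ≠ 0 := by
    rw [← pow_succ']; exact one_sub_qpow_ne_zero hq (by omega)
  have hodd : Filter.Tendsto (fun N : ℕ => 2 * N + 1) Filter.atTop Filter.atTop :=
    Filter.tendsto_atTop_mono (fun N => by rw [id]; omega) Filter.tendsto_id
  have hsucc := Filter.tendsto_add_atTop_nat 1
  have n1 := qShiftedInf_ne_zero hq kq
  have n2 := qShiftedInf_ne_zero hq2 H₁
  have n3 := qShiftedInf_ne_zero hq2 H₂
  have n4 : qShiftedInf (-q) q ≠ 0 := qShiftedInf_ne_zero hq fun n => by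
    rw [neg_mul, sub_neg_eq_add, ← pow_succ']
    exact one_add_qpow_ne_zero hq (by omega)
  have L1 := (tendsto_baileySum hq k2 k4).add (tendsto_baileySum hq k1' k3')
  have L2 := (((tendsto_qShifted (-q) hq).comp hodd).const_mul 2).div
    (((tendsto_qShifted q hq).comp hodd).mul (((tendsto_qShifted (a ^ 2) hq2).comp hsucc).mul
      ((tendsto_qShifted (q ^ 2 / a ^ 2) hq2).comp hsucc))) (mul_ne_zero n1 (mul_ne_zero n2 n3))
  have E := tendsto_nhds_unique L1
    (L2.congr fun N => (baileySum_add_baileySum_neg hq ha H₁ H₂ N).symm)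
  -- Since `(q²;q²)_∞ = (q;q)_∞ (-q;q)_∞`, multiplying `(-q;q)_∞ / (q;q)_∞` by `(q²;q²)_∞²` gives
  -- `(-q;q)_∞² (q²;q²)_∞`.
  rw [← add_div, qShiftedInf_sq_sq hq] at E
  have S := (summable_norm_wellPoisedTerm hq k2 k4).of_norm.hasSum.add
    (summable_norm_wellPoisedTerm hq k1' k3').of_norm.hasSum
  have V : 2 * ((qShiftedInf (-q) q ^ 2 * qShiftedInf (q ^ 2) (q ^ 2)) /
      (qShiftedInf (a ^ 2) (q ^ 2) * qShiftedInf (q ^ 2 / a ^ 2) (q ^ 2))) =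
      ∑' n, wellPoisedTerm q a n + ∑' n, wellPoisedTerm q (-a) n := by
    rw [qShiftedInf_sq_sq hq]
    field_simp at E ⊢
    linear_combination -E
  rw [V]
  refine (congrArg (HasSum · _) (funext fun n => ?_)).mpr S
  simp only [wellPoisedTerm, neg_neg, div_neg, neg_div]
  ring
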